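/- A machine is a partial computable function $V:\{0,1\}^*\rightharpoonup\{0,1\}^*$, and $K_V(x)=\min\{|p| : V(p)=x\}$ (with $\min\emptyset=\infty$) is the Kolmogorov complexity of $x$ relative to $V$. Let $U$ be a universal machine, that is, a machine such that for every machine $V$ there is a constant $c_V$ with $K_U(x)\le K_V(x)+c_V$ for all $x\in\{0,1\}^*$. Write $K=K_U$, and let $R_K=\{x\in\{0,1\}^* : K(x)\ge |x|\}$ be the set of Kolmogorov-random strings. For $t:\mathbb N\to\mathbb N$ and $f:\mathbb N\to\mathbb R$, let $\mathrm{DTIME}(t)/f$ be the class of languages $L\subseteq\{0,1\}^*$ for which there are an advice function $\alpha:\mathbb N\to\{0,1\}^*$ (not necessarily computable) with $|\alpha(n)|\le f(n)$ for all $n$, a deterministic multitape Turing machine $M$ with random access to its two inputs, and a constant $c$ such that, for every $x\in\{0,1\}^*$, $M(x,\alpha(|x|))$ halts within $c\,t(|x|)+c$ steps, and accepts if and only if $x\in L$. For a class $C$ of languages, let $\text{i.o.-}C$ be the class of languages $L$ for which there is an $L'\in C$ with $L\cap\{0,1\}^n=L'\cap\{0,1\}^n$ for infinitely many $n$. **Theorem.**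 For every computable time bound $t:\mathbb N\to\mathbb N$ there is a constant $d_t\in\mathbb N$ such that $$R_K\notin \text{i.o.-}\mathrm{DTIME}(t)/2^{\,n-d_t}.$$ -/

import Mathlib

open Filter

/-! ### Plain Kolmogorov complexity -/

/-- The Kolmogorov complexity of the string `x` relative to the machine `V` (a partial computable
map from programs to outputs): the least length of a program on which `V` outputs `x`,
and `⊤` if there is none. -/
noncomputable def kolmogorov (V : List Bool →. List Bool) (x : List Bool) : ℕ∞ :=
  sInf {l : ℕ∞ | ∃ p : List Bool, x ∈ V p ∧ l = (p.length : ℕ∞)}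

/-- `U` is a universal (additively optimal) machine: it is partial computable, and for every
partial computable `V` there is a constant `c` with `K_U(x) ≤ K_V(x) + c` for all `x`. -/
def IsUniversalMachine (U : List Bool →. List Bool) : Prop :=
  Partrec U ∧ ∀ V : List Bool →. List Bool, Partrec V →
    ∃ c : ℕ, ∀ x : List Bool, kolmogorov U x ≤ kolmogorov V x + (c : ℕ∞)

/-- The set `R_K` of Kolmogorov-random strings, those with `K(x) ≥ |x|`. -/
def randomStrings (U : List Bool →. List Bool) : Set (List Bool) :=
  {x | (x.length : ℕ∞) ≤ kolmogorov U x}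

/-! ### Multitape Turing machines with random access to their input -/

/-- A tape symbol: a blank (`none`), a bit, or one of `m` auxiliary symbols. -/
abbrev TapeSymbol (m : ℕ) : Type := Option (Bool ⊕ Fin m)

/-- The number whose binary digits, least significant first, are the bits at the beginning of a
word, up to the first cell that does not hold a bit. -/
def wordValue {m : ℕ} : List (TapeSymbol m) → ℕ
  | some (Sum.inl b) :: l => b.toNat + 2 * wordValue l
  | _ => 0

theorem wordValue_append_blanks {m : ℕ} (l : List (TapeSymbol m)) (n : ℕ) :
    wordValue (l ++ List.replicate n default) = wordValue l := by
  induction l with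
  | nil => cases n <;> rfl
  | cons a l ih =>
    rcases a with _ | b | j
    · rfl
    · simp only [List.cons_append, wordValue, ih]
    · rfl

/-- The number written in binary on a tape, least significant bit first, from the head
rightwards up to the first cell that does not hold a bit. -/
def tapeValue {m : ℕ} (T : Turing.Tape (TapeSymbol m)) : ℕ :=
  (T.right.cons T.head).liftOn wordValue (by
    rintro a _ ⟨n, rfl⟩
    exact (wordValue_append_blanks a n).symm)

/-- What a read-only input head can do in one step: move one cell left (staying in place on the
leftmost cell), stay, move one cell right, or jump to the cell whose index is written in binary on
the address tape. -/
inductive InputMove : Type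
  | left
  | stay
  | right
  | jump

/-- The new position of an input head at position `p` when the address tape holds `a`. -/
def InputMove.apply (a p : ℕ) : InputMove → ℕ
  | .left => p - 1
  | .stay => p
  | .right => p + 1
  | .jump => a

/-- A deterministic Turing machine with two read-only random-access input tapes, one for the
input and one for the advice, and finitely many (at least one) two-way infinite work tapes. Work
tape `0` also serves as the address tape. -/
structure AdviceTM where
  /-- the number of states -/
  numStates : ℕ
  /-- the number of auxiliary tape symbols -/
  numAux : ℕ
  /-- the number of work tapes besides the address tape -/
  numTapes : ℕ
  /-- the initial state -/
  start : Fin numStates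
  /-- the accepting halting state -/
  accept : Fin numStates
  /-- the rejecting halting state -/
  reject : Fin numStates
  accept_ne_reject : accept ≠ reject
  /-- The transition function. From the state, the symbols under the two input heads (`none` beyond
  the end of the string) and the symbols under the work heads, it gives the new state, the moves of
  the two input heads, and for each work tape the symbol to write and the move to make thereafter
  (`none` for staying in place). -/
  trans : Fin numStates → Option Bool → Option Bool →
    (Fin (numTapes + 1) → TapeSymbol numAux) →
    Fin numStates × InputMove × InputMove ×
      (Fin (numTapes + 1) → TapeSymbol numAux × Option Turing.Dir)

namespace AdviceTM

/-- A configuration: state, positions of the two input heads, work tapes. -/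
structure Cfg (M : AdviceTM) where
  state : Fin M.numStates
  inputPos : ℕ
  advicePos : ℕ
  tapes : Fin (M.numTapes + 1) → Turing.Tape (TapeSymbol M.numAux)

/-- The initial configuration: heads at the beginning, work tapes blank. -/
def init (M : AdviceTM) : M.Cfg where
  state := M.start
  inputPos := 0
  advicePos := 0
  tapes := fun _ => default

/-- A configuration is halted if it is in the accepting or in the rejecting state. -/
def Cfg.Halted {M : AdviceTM} (C : M.Cfg) : Prop :=
  C.state = M.accept ∨ C.state = M.reject

instance {M : AdviceTM} (C : M.Cfg) : Decidable C.Halted :=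
  inferInstanceAs (Decidable (_ ∨ _))

/-- One step of `M` on the input `x` with advice `y`; halted configurations do not change. -/
def step (M : AdviceTM) (x y : List Bool) (C : M.Cfg) : M.Cfg :=
  if C.Halted then C else
    let r := M.trans C.state x[C.inputPos]? y[C.advicePos]? (fun i => (C.tapes i).head)
    let a := tapeValue (C.tapes 0)
    { state := r.1
      inputPos := r.2.1.apply a C.inputPos
      advicePos := r.2.2.1.apply a C.advicePos
      tapes := fun i =>
        let T := (C.tapes i).write (r.2.2.2 i).1
        match (r.2.2.2 i).2 with
        | none => T
        | some dir => T.move dir }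

/-- The configuration of `M` on input `x` with advice `y` after `s` steps. -/
def run (M : AdviceTM) (x y : List Bool) (s : ℕ) : M.Cfg :=
  (M.step x y)^[s] M.init

/-- `M(x, y)` halts within `s` steps. -/
def HaltsWithin (M : AdviceTM) (x y : List Bool) (s : ℕ) : Prop :=
  (M.run x y s).Halted

/-- `M(x, y)` accepts. -/
def Accepts (M : AdviceTM) (x y : List Bool) : Prop :=
  ∃ s : ℕ, (M.run x y s).state = M.accept

end AdviceTM

/-! ### Complexity classes -/

/-- `DTIME(t)/α` for an advice function `α`: the languages `L` for which some machine `M` is such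
that, for every `x`, `M(x, α(|x|))` halts in time `O(t(|x|))`, and accepts iff `x ∈ L`.
The running time depends on the length of `x` alone, and nothing is required of `M` on other
advice strings. -/
def DTIMEWithAdvice (t : ℕ → ℕ) (α : ℕ → List Bool) : Set (Set (List Bool)) :=
  {L | ∃ (M : AdviceTM) (c : ℕ), ∀ x : List Bool,
    M.HaltsWithin x (α x.length) (c * t x.length + c) ∧
      (M.Accepts x (α x.length) ↔ x ∈ L)}

/-- `DTIME(t)/f`: the union of `DTIME(t)/α` over all `α` with `|α(n)| ≤ f(n)` for all `n`. -/
def DTIMEAdvice (t : ℕ → ℕ) (f : ℕ → ℝ) : Set (Set (List Bool)) :=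
  {L | ∃ α : ℕ → List Bool, (∀ n, ((α n).length : ℝ) ≤ f n) ∧ L ∈ DTIMEWithAdvice t α}

/-- `i.o.-C`: the languages that agree with some language of `C` on all strings of length `n`,
for infinitely many `n`. -/
def InfinitelyOften (C : Set (Set (List Bool))) : Set (Set (List Bool)) :=
  {L | ∃ L' ∈ C, ∃ᶠ n : ℕ in atTop, ∀ x : List Bool, x.length = n → (x ∈ L ↔ x ∈ L')}

/-!
Random strings are plentiful, and a set of random strings that is both plentiful and easy to decide
is hit by a short computable list, whose members then have short descriptions.

In detail, a fraction `2 ^ (-e₀)` of the strings of each length is random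
(`IsUniversalMachine.exists_two_pow_le_length_randomWords`): given the length and the number of
random strings, the random strings can be computed by waiting until all others have been produced
by short programs, so too small a number would itself be a short description of a random string.

Now let `n` be a length on which a decider with advice of length at most `2 ^ r`, `r = n - d`,
decides the random strings. The candidates for it are the pairs of a decider among the first `n` and
an advice string; there are fewer than `2 ^ 2 ^ (r + 2)` of them (`mul_length_shortWords_lt`).
A greedy choice (`exists_hitting_list`) shows that some list of `2 ^ (r + 2 + e₀)` strings meets the
set accepted by every candidate that accepts a fraction `2 ^ (-e₀)` of all strings. The first list
with this property can be found by search. Each of its entries is given by its position, that is, by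
`r + 2 + e₀` bits, so all of them have complexity less than `n` if `d` exceeds `e₀ + 2` by a
sufficient constant. But the list meets the set of random strings, a contradiction.

The search needs an enumeration of deciders that all halt. Because the bound `t` on the running time
is computable and can be handed to the decider as a number, a decider with running time `O(t)` is a
primitive recursive function of the input, the advice and the value of `t`
(`exists_primrec_decider`). Primitive recursive functions are enumerated by the codes without
unbounded search (`Nat.Partrec.Code.rfindFree`).

In both arguments the computation has to know the overhead `e` that the universal machine
imposes on its descriptions, while `e` depends on that computation. A self-delimiting prefix of the
program resolves this (`IsUniversalMachine.exists_kolmogorov_lt`).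
-/

/-! ### Simulating a fixed machine by a primitive recursive function -/

/-- A function whose first argument ranges over a finite type is primitive recursive as soon as all
its sections are. Since a machine is finite, this reduces its transition function to constants. -/
theorem Primrec₂.of_finite_left {α β σ : Type*} [Primcodable α] [Primcodable β] [Primcodable σ]
    [Finite α] {f : α → β → σ} (hf : ∀ a, Primrec (f a)) : Primrec₂ f := by
  obtain ⟨n, ⟨e⟩⟩ := Finite.exists_equiv_fin α
  have h : Primrec₂ fun (i : Fin n) b => f (e.symm i) b :=
    Primrec.fin_curry₁.2 fun i => hf (e.symm i)
  exact (h.comp ((Primrec.dom_finite e).comp Primrec.fst) Primrec.snd).of_eq fun a => by simp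

theorem primrec_wordValue (m : ℕ) : Primrec (wordValue (m := m)) := by
  let f : TapeSymbol m → ℕ → ℕ
    | some (Sum.inl b), v => b.toNat + 2 * v
    | _, _ => 0
  have hf : Primrec₂ f := by
    refine Primrec₂.of_finite_left fun a => ?_
    rcases a with _ | b | j
    · exact Primrec.const 0
    · exact Primrec.nat_add.comp (Primrec.const _)
        (Primrec.nat_mul.comp (Primrec.const 2) Primrec.id)
    · exact Primrec.const 0
  refine (Primrec.list_foldr (f := id) (g := fun _ => 0)
    (h := fun (_ : List (TapeSymbol m)) p => f p.1 p.2) Primrec.id (Primrec.const 0)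
    (hf.comp (Primrec.fst.comp Primrec.snd) (Primrec.snd.comp Primrec.snd))).of_eq fun l => ?_
  induction l with
  | nil => rfl
  | cons a l ih =>
    rcases a with _ | b | j
    · rfl
    · simp only [id, List.foldr_cons, f, wordValue] at ih ⊢
      rw [ih]
    · rfl

namespace AdviceTM

/-- A finite description of a configuration: the state, the two input positions, and for each work
tape the cells to the left of the head (nearest first) and those from the head rightwards. Blanks
at the far ends may be left out. -/
abbrev ListCfg (M : AdviceTM) : Type :=
  Fin M.numStates × ℕ × ℕ ×
    (Fin (M.numTapes + 1) → List (TapeSymbol M.numAux) × List (TapeSymbol M.numAux))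

/-- The configuration that a finite description stands for. -/
def ListCfg.toCfg {M : AdviceTM} (C : M.ListCfg) : M.Cfg :=
  ⟨C.1, C.2.1, C.2.2.1, fun i => Turing.Tape.mk₂ (C.2.2.2 i).1 (C.2.2.2 i).2⟩

/-- Writing a symbol and then moving, on a tape given by two lists. -/
def listTapeAct {Γ : Type*} [Inhabited Γ] (o : Γ × Option Turing.Dir) (T : List Γ × List Γ) :
    List Γ × List Γ :=
  match o.2 with
  | none => (T.1, o.1 :: T.2.tail)
  | some .left => (T.1.tail, T.1.headI :: o.1 :: T.2.tail)
  | some .right => (o.1 :: T.1, T.2.tail)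

theorem mk₂_listTapeAct {Γ : Type*} [Inhabited Γ] (o : Γ × Option Turing.Dir)
    (T : List Γ × List Γ) :
    Turing.Tape.mk₂ (listTapeAct o T).1 (listTapeAct o T).2 =
      match o.2 with
      | none => (Turing.Tape.mk₂ T.1 T.2).write o.1
      | some dir => ((Turing.Tape.mk₂ T.1 T.2).write o.1).move dir := by
  rcases o with ⟨b, _ | _ | _⟩ <;> simp [listTapeAct, Turing.Tape.mk₂]

/-- What a machine sees in one step: its state and the symbols under all its heads. -/
abbrev View (M : AdviceTM) : Type :=
  Fin M.numStates × Option Bool × Option Bool × (Fin (M.numTapes + 1) → TapeSymbol M.numAux)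

/-- The effect on a finite description of the transition that the view `v` calls for. -/
def listAct (M : AdviceTM) (v : M.View) (C : M.ListCfg) : M.ListCfg :=
  if v.1 = M.accept ∨ v.1 = M.reject then C else
    let r := M.trans v.1 v.2.1 v.2.2.1 v.2.2.2
    let a := wordValue (C.2.2.2 0).2
    (r.1, r.2.1.apply a C.2.1, r.2.2.1.apply a C.2.2.1,
      fun i => listTapeAct (r.2.2.2 i) (C.2.2.2 i))

/-- The counterpart of `AdviceTM.step` on finite descriptions. -/
def listStep (M : AdviceTM) (x y : List Bool) (C : M.ListCfg) : M.ListCfg :=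
  M.listAct (C.1, x[C.2.1]?, y[C.2.2.1]?, fun i => (C.2.2.2 i).2.headI) C

/-- The description of the initial configuration. -/
def listInit (M : AdviceTM) : M.ListCfg := (M.start, 0, 0, fun _ => ([], []))

theorem toCfg_listStep (M : AdviceTM) (x y : List Bool) (C : M.ListCfg) :
    (M.listStep x y C).toCfg = M.step x y C.toCfg := by
  have hv (R : List (TapeSymbol M.numAux)) : wordValue (R.headI :: R.tail) = wordValue R := by
    cases R <;> rfl
  by_cases h : C.1 = M.accept ∨ C.1 = M.reject
  · have h' : C.toCfg.Halted := h
    simp [listStep, listAct, step, h, h']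
  · have h' : ¬ C.toCfg.Halted := h
    have ht : tapeValue (C.toCfg.tapes 0) = wordValue (C.2.2.2 0).2 := hv _
    simp only [listStep, listAct, step, h, h', if_false, ht]
    exact congrArg (Cfg.mk _ _ _) (funext fun i => mk₂_listTapeAct _ _)

theorem toCfg_listRun (M : AdviceTM) (x y : List Bool) (s : ℕ) :
    ((M.listStep x y)^[s] M.listInit).toCfg = M.run x y s := by
  induction s with
  | zero => rfl
  | succ s ih =>
    rw [run, Function.iterate_succ_apply', Function.iterate_succ_apply', toCfg_listStep, ih, run]

theorem primrec_inputMove_apply (m : InputMove) :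
    Primrec₂ fun a p : ℕ => m.apply a p := by
  cases m
  · exact Primrec.pred.comp Primrec.snd
  · exact Primrec.snd
  · exact Primrec.succ.comp Primrec.snd
  · exact Primrec.fst

theorem primrec_listTapeAct {Γ : Type*} [Inhabited Γ] [Primcodable Γ]
    (o : Γ × Option Turing.Dir) : Primrec (listTapeAct o) := by
  have h1 : Primrec fun T : List Γ × List Γ => o.1 :: T.2.tail :=
    Primrec.list_cons.comp (Primrec.const _) (Primrec.list_tail.comp Primrec.snd)
  rcases o with ⟨b, _ | _ | _⟩
  · exact Primrec.fst.pair h1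
  · exact (Primrec.list_tail.comp Primrec.fst).pair
      (Primrec.list_cons.comp (Primrec.list_headI.comp Primrec.fst) h1)
  · exact (Primrec.list_cons.comp (Primrec.const _) Primrec.fst).pair
      (Primrec.list_tail.comp Primrec.snd)

theorem primrec_tape (M : AdviceTM) (i : Fin (M.numTapes + 1)) :
    Primrec fun C : M.ListCfg => C.2.2.2 i :=
  Primrec.fin_app.comp (Primrec.snd.comp (Primrec.snd.comp Primrec.snd)) (Primrec.const i)

theorem primrec_listAct (M : AdviceTM) : Primrec₂ M.listAct := by
  refine Primrec₂.of_finite_left fun v => ?_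
  unfold listAct
  split_ifs
  · exact Primrec.id
  · have ha : Primrec fun C : M.ListCfg => wordValue (C.2.2.2 0).2 :=
      (primrec_wordValue _).comp (Primrec.snd.comp (M.primrec_tape 0))
    refine (Primrec.const _).pair (((primrec_inputMove_apply _).comp ha
      (Primrec.fst.comp Primrec.snd)).pair (((primrec_inputMove_apply _).comp ha
      (Primrec.fst.comp (Primrec.snd.comp Primrec.snd))).pair ?_))
    exact Primrec.fin_curry.2 (Primrec₂.swap (Primrec.fin_curry₁.2 fun i =>
      (primrec_listTapeAct _).comp (M.primrec_tape i)))

theorem primrec_listStep (M : AdviceTM) :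
    Primrec fun p : (List Bool × List Bool) × M.ListCfg => M.listStep p.1.1 p.1.2 p.2 := by
  refine M.primrec_listAct.comp (Primrec.pair (Primrec.fst.comp Primrec.snd)
    (Primrec.pair ?_ (Primrec.pair ?_ ?_))) Primrec.snd
  · exact Primrec.list_getElem?.comp (Primrec.fst.comp Primrec.fst)
      (Primrec.fst.comp (Primrec.snd.comp Primrec.snd))
  · exact Primrec.list_getElem?.comp (Primrec.snd.comp Primrec.fst)
      (Primrec.fst.comp (Primrec.snd.comp (Primrec.snd.comp Primrec.snd)))
  · exact Primrec.fin_curry.2 (Primrec₂.swap (Primrec.fin_curry₁.2 fun i =>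
      Primrec.list_headI.comp (Primrec.snd.comp ((M.primrec_tape i).comp Primrec.snd))))

theorem state_run_eq_of_halted (M : AdviceTM) {x y : List Bool} {s s' : ℕ} (h : s ≤ s')
    (hs : (M.run x y s).Halted) : M.run x y s' = M.run x y s := by
  induction s', h using Nat.le_induction with
  | base => rfl
  | succ k _ ih =>
    have : M.run x y (k + 1) = M.step x y (M.run x y k) := Function.iterate_succ_apply' _ _ _
    rw [this, ih, step, if_pos hs]

theorem accepts_iff_of_haltsWithin (M : AdviceTM) {x y : List Bool} {s : ℕ}
    (hs : M.HaltsWithin x y s) : M.Accepts x y ↔ (M.run x y s).state = M.accept := by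
  refine ⟨fun ⟨k, hk⟩ => ?_, fun h => ⟨s, h⟩⟩
  rcases le_total k s with h | h
  · rw [M.state_run_eq_of_halted h (Or.inl hk), hk]
  · rw [← M.state_run_eq_of_halted h hs, hk]

end AdviceTM

/-- On inputs with the right advice, a machine with running time `O(t)` can be replaced by a
primitive recursive function that is also given the value of `t`. -/
theorem exists_primrec_decider {t : ℕ → ℕ} {α : ℕ → List Bool} {L : Set (List Bool)}
    (h : L ∈ DTIMEWithAdvice t α) :
    ∃ g : List Bool × List Bool × ℕ → Bool, Primrec g ∧
      ∀ x, x ∈ L ↔ g (x, α x.length, t x.length) = true := by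
  obtain ⟨M, c, hM⟩ := h
  have hrun : Primrec fun p : List Bool × List Bool × ℕ =>
      (M.listStep p.1 p.2.1)^[c * p.2.2 + c] M.listInit :=
    Primrec.nat_iterate
      (Primrec.nat_add.comp (Primrec.nat_mul.comp (Primrec.const c)
        (Primrec.snd.comp Primrec.snd)) (Primrec.const c))
      (Primrec.const M.listInit)
      (M.primrec_listStep.comp (Primrec.pair (Primrec.pair (Primrec.fst.comp Primrec.fst)
        (Primrec.fst.comp (Primrec.snd.comp Primrec.fst))) Primrec.snd))
  refine ⟨fun p => decide (((M.listStep p.1 p.2.1)^[c * p.2.2 + c] M.listInit).1 = M.accept),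
    (Primrec.eq.comp (Primrec.fst.comp hrun) (Primrec.const M.accept)).decide, fun x => ?_⟩
  rw [← (hM x).2, M.accepts_iff_of_haltsWithin (hM x).1, ← M.toCfg_listRun, decide_eq_true_iff]
  rfl

/-! ### Programs for primitive recursive functions -/

namespace Nat.Partrec.Code

/-- Whether a code contains no unbounded search. Such codes are exactly those that present
primitive recursive functions, so they are total. -/
def rfindFree (c : Code) : Bool :=
  Code.recOn c true true true true (fun _ _ a b => a && b) (fun _ _ a b => a && b)
    (fun _ _ a b => a && b) (fun _ _ => false)

theorem primrec_rfindFree : Primrec rfindFree := by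
  have hand : Primrec fun a : Code × Code × Code × Bool × Bool => a.2.2.2.1 && a.2.2.2.2 :=
    Primrec.and.comp (Primrec.fst.comp (Primrec.snd.comp (Primrec.snd.comp Primrec.snd)))
      (Primrec.snd.comp (Primrec.snd.comp (Primrec.snd.comp Primrec.snd)))
  exact primrec_recOn (α := Code) (σ := Bool) (c := id) _root_.Primrec.id
    (z := fun _ => true) (_root_.Primrec.const _) (s := fun _ => true) (_root_.Primrec.const _)
    (l := fun _ => true) (_root_.Primrec.const _) (r := fun _ => true) (_root_.Primrec.const _)
    (pr := fun _ _ _ a b => a && b) hand (co := fun _ _ _ a b => a && b) hand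
    (pc := fun _ _ _ a b => a && b) hand (rf := fun _ _ _ => false) (_root_.Primrec.const _)

theorem eval_dom_of_rfindFree {c : Code} (hc : c.rfindFree = true) (n : ℕ) :
    (eval c n).Dom := by
  induction c generalizing n with
  | zero | succ | left | right => trivial
  | pair cf cg hf hg =>
    obtain ⟨h1, h2⟩ := Bool.and_eq_true_iff.1 hc
    obtain ⟨a, ha⟩ := Part.dom_iff_mem.1 (hf h1 n)
    obtain ⟨b, hb⟩ := Part.dom_iff_mem.1 (hg h2 n)
    refine Part.dom_iff_mem.2 ⟨Nat.pair a b, ?_⟩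
    simp only [eval, Part.eq_some_iff.2 ha, Part.eq_some_iff.2 hb]
    simp [Seq.seq]
  | comp cf cg hf hg =>
    obtain ⟨h1, h2⟩ := Bool.and_eq_true_iff.1 hc
    exact Part.bind_dom.2 ⟨hg h2 n, hf h1 _⟩
  | prec cf cg hf hg =>
    obtain ⟨h1, h2⟩ := Bool.and_eq_true_iff.1 hc
    rw [← Nat.pair_unpair n]
    induction n.unpair.2 with
    | zero => rw [eval_prec_zero]; exact hf h1 _
    | succ k ih =>
      rw [eval_prec_succ]
      exact Part.bind_dom.2 ⟨ih, hg h2 _⟩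
  | rfind' cf _ => exact absurd hc Bool.false_ne_true

theorem exists_rfindFree {f : ℕ → ℕ} (hf : Nat.Primrec f) :
    ∃ c : Code, c.rfindFree = true ∧ ∀ n, eval c n = Part.some (f n) := by
  induction hf with
  | zero => exact ⟨zero, rfl, fun _ => rfl⟩
  | succ => exact ⟨succ, rfl, fun _ => rfl⟩
  | left => exact ⟨left, rfl, fun _ => rfl⟩
  | right => exact ⟨right, rfl, fun _ => rfl⟩
  | pair _ _ hf hg =>
    obtain ⟨cf, hf, ef⟩ := hf
    obtain ⟨cg, hg, eg⟩ := hg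
    exact ⟨pair cf cg, Bool.and_eq_true_iff.2 ⟨hf, hg⟩, fun n => by simp [eval, ef, eg, Seq.seq]⟩
  | comp _ _ hf hg =>
    obtain ⟨cf, hf, ef⟩ := hf
    obtain ⟨cg, hg, eg⟩ := hg
    exact ⟨comp cf cg, Bool.and_eq_true_iff.2 ⟨hf, hg⟩, fun n => by
      simp only [eval, eg]
      exact (Part.bind_some _ _).trans (ef _)⟩
  | prec _ _ hf hg =>
    obtain ⟨cf, hf, ef⟩ := hf
    obtain ⟨cg, hg, eg⟩ := hg
    refine ⟨prec cf cg, Bool.and_eq_true_iff.2 ⟨hf, hg⟩, fun n => ?_⟩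
    rw [← Nat.pair_unpair n]
    induction n.unpair.2 with
    | zero => simp [eval_prec_zero, ef]
    | succ k ih =>
      rw [eval_prec_succ, ih]
      simp [eg]

end Nat.Partrec.Code

/-! ### Enumerating strings -/

/-- The strings of length `n`, each listed once. -/
def words : ℕ → List (List Bool)
  | 0 => [[]]
  | n + 1 => (words n).flatMap fun w => [false :: w, true :: w]

theorem mem_words {n : ℕ} {w : List Bool} : w ∈ words n ↔ w.length = n := by
  induction n generalizing w with
  | zero => simp [words]
  | succ n ih =>
    rcases w with _ | ⟨b, w⟩
    · simp [words]
    · cases b <;> simp [words, ih]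

theorem length_words (n : ℕ) : (words n).length = 2 ^ n := by
  induction n with
  | zero => rfl
  | succ n ih => simp [words, ih, pow_succ]

theorem nodup_words (n : ℕ) : (words n).Nodup := by
  induction n with
  | zero => simp [words]
  | succ n ih =>
    refine List.nodup_flatMap.2 ⟨fun w _ => by simp, ih.imp fun {a b} hab => ?_⟩
    simp only [Function.onFun, List.disjoint_left]
    intro w
    simp only [List.mem_cons, List.not_mem_nil, or_false]
    rintro (rfl | rfl) <;> simp [hab]

theorem primrec_words : Primrec words := by
  have h : Primrec₂ fun (_ : ℕ) (l : List (List Bool)) =>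
      l.flatMap fun w => [false :: w, true :: w] :=
    Primrec.list_flatMap Primrec.snd
      (Primrec.list_cons.comp (Primrec.list_cons.comp (Primrec.const _) Primrec.snd)
        (Primrec.list_cons.comp (Primrec.list_cons.comp (Primrec.const _) Primrec.snd)
          (Primrec.const [])))
  refine (Primrec.nat_rec₁ [[]] h).of_eq fun n => ?_
  induction n with
  | zero => rfl
  | succ n ih => simp only [words, ← ih]

/-- The strings of length less than `n`. -/
def shortWords (n : ℕ) : List (List Bool) := (List.range n).flatMap words

theorem mem_shortWords {n : ℕ} {w : List Bool} : w ∈ shortWords n ↔ w.length < n := by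
  simp [shortWords, mem_words]

theorem length_shortWords_lt (n : ℕ) : (shortWords n).length < 2 ^ n := by
  induction n with
  | zero => simp [shortWords]
  | succ n ih =>
    have : shortWords (n + 1) = shortWords n ++ words n := by simp [shortWords, List.range_succ]
    rw [this, List.length_append, length_words, pow_succ]
    omega

theorem primrec_shortWords : Primrec shortWords :=
  Primrec.list_flatMap Primrec.list_range (primrec_words.comp Primrec.snd)

/-! ### Descriptions with a self-delimiting parameter -/

theorem kolmogorov_le {V : List Bool →. List Bool} {p x : List Bool} (h : x ∈ V p) :
    kolmogorov V x ≤ p.length :=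
  sInf_le ⟨p, h, rfl⟩

theorem not_mem_randomStrings_iff {U : List Bool →. List Bool} {x : List Bool} :
    x ∉ randomStrings U ↔ ∃ p ∈ shortWords x.length, x ∈ U p := by
  simp only [randomStrings, Set.mem_ofPred_eq, not_le, kolmogorov, sInf_lt_iff, mem_shortWords]
  constructor
  · rintro ⟨_, ⟨p, hp, rfl⟩, h⟩
    exact ⟨p, by exact_mod_cast h, hp⟩
  · rintro ⟨p, h, hp⟩
    exact ⟨_, ⟨p, hp, rfl⟩, by exact_mod_cast h⟩

/-- A partial computable `W` that is told its own overhead `e` and a number `v < 2 ^ m` produces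
only strings of complexity less than `m + e`, for a suitable `e`. A program `1ᵃ0q` with `|q| = m`
is read as the parameter `e = 2a + 1` and the index `v` of `q`. It is shorter than `m + e` by `a`,
so it suffices that `a` exceeds the cost of passing to the universal machine, a constant that does
not depend on `a`. -/
theorem IsUniversalMachine.exists_kolmogorov_lt {U : List Bool →. List Bool}
    (hU : IsUniversalMachine U) {W : ℕ × ℕ × ℕ →. List Bool} (hW : Partrec W) :
    ∃ e : ℕ, ∀ m v x, v < 2 ^ m → x ∈ W (e, m, v) →
      kolmogorov U x < ((m + e : ℕ) : ℕ∞) := by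
  let a (p : List Bool) : ℕ := (p.takeWhile id).length
  let q (p : List Bool) : List Bool := (p.dropWhile id).tail
  have ha : Primrec a := Primrec.list_length.comp (Primrec.list_takeWhile Primrec.id)
  have hq : Primrec q := Primrec.list_tail.comp (Primrec.list_dropWhile Primrec.id)
  have hql : Primrec fun p => (q p).length := Primrec.list_length.comp hq
  let V : List Bool →. List Bool := fun p =>
    W (2 * a p + 1, (q p).length, (words (q p).length).idxOf (q p))
  have hidx : Primrec fun p => (words (q p).length).idxOf (q p) :=
    (Primrec.list_idxOf.comp hq (primrec_words.comp hql)).of_eq fun p => by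
      rw [lawful_beq_subsingleton instBEqOfDecidableEq (List.instBEq (α := Bool))]
  have hV : Partrec V := hW.comp (Primrec.to_comp
    ((Primrec.succ.comp (Primrec.nat_mul.comp (Primrec.const 2) ha)).pair
      (hql.pair hidx)))
  obtain ⟨c, hc⟩ := hU.2 V hV
  refine ⟨2 * (c + 1) + 1, fun m v x hv hx => ?_⟩
  rw [← length_words] at hv
  have hr : ((words m)[v]).length = m := mem_words.1 (List.getElem_mem hv)
  have hx' : x ∈ V (List.replicate (c + 1) true ++ false :: (words m)[v]) := by
    have h1 : a (List.replicate (c + 1) true ++ false :: (words m)[v]) = c + 1 := by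
      simp [a]
    have h2 : q (List.replicate (c + 1) true ++ false :: (words m)[v]) = (words m)[v] := by
      simp [q]
    simp only [V, h1, h2, hr]
    rwa [(nodup_words m).idxOf_getElem v hv]
  refine (hc x).trans_lt ((add_le_add_left (kolmogorov_le hx') _).trans_lt ?_)
  simp only [List.length_append, List.length_replicate, List.length_cons, hr]
  norm_cast
  omega

/-! ### A positive fraction of all strings is random -/

theorem mem_iff_encode_mem_eval {α σ : Type*} [Primcodable α] [Primcodable σ] {f : α →. σ}
    {c : Nat.Partrec.Code}
    (hc : c.eval = fun n => Part.bind (Encodable.decode (α := α) n) fun a =>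
      (f a).map Encodable.encode) (a : α) (b : σ) :
    b ∈ f a ↔ Encodable.encode b ∈ c.eval (Encodable.encode a) := by
  simp [hc]

open Nat.Partrec (Code) in
/-- The strings of length `n` that none of the programs of length less than `n` for the code `c`
outputs within `k` steps. They approximate the random strings from above. -/
def unproduced (c : Code) (n k : ℕ) : List (List Bool) :=
  (words n).filter fun x =>
    ∀ p ∈ shortWords n, ¬ Code.evaln k c (Encodable.encode p) = some (Encodable.encode x)

open Nat.Partrec (Code) in
theorem primrec₂_unproduced (c : Code) : Primrec₂ (unproduced c) := by
  have h1 : PrimrecRel fun (p : List Bool) (s : (ℕ × ℕ) × List Bool) =>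
      ¬ Code.evaln s.1.2 c (Encodable.encode p) = some (Encodable.encode s.2) := by
    refine PrimrecPred.not (Primrec.eq.comp (Code.primrec_evaln.comp (Primrec.pair (Primrec.pair
      (Primrec.snd.comp (Primrec.fst.comp Primrec.snd)) (Primrec.const c))
      (Primrec.encode.comp Primrec.fst)))
      (Primrec.option_some.comp (Primrec.encode.comp (Primrec.snd.comp Primrec.snd))))
  have h2 : PrimrecRel fun (x : List Bool) (s : ℕ × ℕ) => ∀ p ∈ shortWords s.1,
      ¬ Code.evaln s.2 c (Encodable.encode p) = some (Encodable.encode x) :=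
    h1.forall_mem_list.comp (primrec_shortWords.comp (Primrec.fst.comp Primrec.snd))
      (Primrec.snd.pair Primrec.fst)
  exact h2.listFilter.comp (primrec_words.comp Primrec.fst) Primrec.id

open Classical in
/-- The random strings of length `n`. -/
noncomputable def randomWords (U : List Bool →. List Bool) (n : ℕ) : List (List Bool) :=
  (words n).filter fun x => x ∈ randomStrings U

theorem mem_randomWords {U : List Bool →. List Bool} {n : ℕ} {x : List Bool} :
    x ∈ randomWords U n ↔ x.length = n ∧ x ∈ randomStrings U := by
  simp [randomWords, mem_words]

/-- There are fewer programs of length less than `n` than strings of length `n`. -/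
theorem randomWords_ne_nil (U : List Bool →. List Bool) (n : ℕ) : randomWords U n ≠ [] := by
  intro h
  have hx : ∀ x ∈ words n, ∃ p ∈ shortWords n, x ∈ U p := fun x hx => by
    obtain rfl := mem_words.1 hx
    refine not_mem_randomStrings_iff.1 fun hr => ?_
    have := mem_randomWords.2 ⟨rfl, hr⟩
    rw [h] at this
    exact List.not_mem_nil this
  choose! f hf using hx
  have hc : (words n).toFinset.card ≤ (shortWords n).toFinset.card := by
    refine Finset.card_le_card_of_injOn f (fun x hx => ?_) fun x hx y hy hxy => ?_
    · simpa using (hf x (by simpa using hx)).1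
    · have h1 := (hf x (by simpa using hx)).2
      have h2 := (hf y (by simpa using hy)).2
      rw [hxy] at h1
      exact Part.mem_unique h1 h2
  rw [List.toFinset_card_of_nodup (nodup_words n), length_words] at hc
  exact absurd (hc.trans (List.toFinset_card_le _)) (not_le.2 (length_shortWords_lt n))

open Nat.Partrec (Code) in
theorem randomWords_sublist_unproduced {U : List Bool →. List Bool} {c : Code}
    (hc : ∀ p x, x ∈ U p ↔ Encodable.encode x ∈ c.eval (Encodable.encode p)) (n k : ℕ) :
    (randomWords U n).Sublist (unproduced c n k) := by
  have h : (unproduced c n k).filter (· ∈ randomWords U n) = randomWords U n := by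
    rw [unproduced, List.filter_filter]
    refine List.filter_congr fun x hx => ?_
    rw [Bool.eq_iff_iff]
    simp only [mem_randomWords, mem_words.1 hx, true_and, Bool.and_eq_true, decide_eq_true_eq,
      and_iff_left_iff_imp]
    intro hr p hp he
    obtain rfl := mem_words.1 hx
    exact not_mem_randomStrings_iff.2 ⟨p, hp, (hc p x).2 (Code.evaln_sound he)⟩ hr
  exact h ▸ List.filter_sublist

open Nat.Partrec (Code) in
theorem exists_unproduced_eq {U : List Bool →. List Bool} {c : Code}
    (hc : ∀ p x, x ∈ U p ↔ Encodable.encode x ∈ c.eval (Encodable.encode p)) (n : ℕ) :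
    ∃ k, unproduced c n k = randomWords U n := by
  have h : ∀ᶠ k in atTop, ∀ x ∈ (words n).toFinset, x ∈ unproduced c n k →
      x ∈ randomStrings U := by
    refine (eventually_all_finset _).2 fun x hx => ?_
    by_cases hr : x ∈ randomStrings U
    · exact Eventually.of_forall fun _ _ => hr
    · obtain ⟨p, hp, hxp⟩ := not_mem_randomStrings_iff.1 hr
      obtain ⟨k₀, hk₀⟩ := Code.evaln_complete.1 ((hc p x).1 hxp)
      obtain rfl := mem_words.1 (List.mem_toFinset.1 hx)
      filter_upwards [eventually_ge_atTop k₀] with k hk hxk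
      have := (List.mem_filter.1 hxk).2
      exact absurd (Code.evaln_mono hk hk₀) (of_decide_eq_true this p hp)
  obtain ⟨k, hk⟩ := h.exists
  refine ⟨k, ?_⟩
  have hs := randomWords_sublist_unproduced hc n k
  refine (hs.eq_of_length_le ?_).symm
  refine (((nodup_words n).filter _).subperm fun x hx => ?_).length_le
  have hw := (List.mem_filter.1 hx).1
  exact mem_randomWords.2 ⟨mem_words.1 hw, hk x (List.mem_toFinset.2 hw) hx⟩

open Nat.Partrec (Code) in
/-- For some `e`, at least a fraction `2 ^ (-e)` of the strings of length `n ≥ e` is random.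
Knowing `n` and the number of random strings, one can find them all, so if that number had a
description of `n - e` bits, a random string would have complexity less than `n`. -/
theorem IsUniversalMachine.exists_two_pow_le_length_randomWords {U : List Bool →. List Bool}
    (hU : IsUniversalMachine U) : ∃ e : ℕ, ∀ m, 2 ^ m ≤ (randomWords U (m + e)).length := by
  obtain ⟨c, hc⟩ := Code.exists_code.1 hU.1
  have hc := mem_iff_encode_mem_eval hc
  let f (s : ℕ × ℕ × ℕ) (k : ℕ) : Option (List Bool) :=
    if (unproduced c (s.2.1 + s.1) k).length ≤ s.2.2 then
      (unproduced c (s.2.1 + s.1) k).head? else none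
  have hf : Primrec₂ f := by
    have h1 : Primrec fun a : (ℕ × ℕ × ℕ) × ℕ => unproduced c (a.1.2.1 + a.1.1) a.2 :=
      (primrec₂_unproduced c).comp (Primrec.nat_add.comp
        (Primrec.fst.comp (Primrec.snd.comp Primrec.fst)) (Primrec.fst.comp Primrec.fst))
        Primrec.snd
    exact Primrec.ite (Primrec.nat_le.comp (Primrec.list_length.comp h1)
      (Primrec.snd.comp (Primrec.snd.comp Primrec.fst))) (Primrec.list_head?.comp h1)
      (Primrec.const none)
  obtain ⟨e, he⟩ := hU.exists_kolmogorov_lt (Partrec.rfindOpt hf.to_comp)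
  refine ⟨e, fun m => le_of_not_gt fun hlt => ?_⟩
  obtain ⟨k, hk⟩ := exists_unproduced_eq hc (m + e)
  obtain ⟨x, hx⟩ : ∃ x, x ∈ Nat.rfindOpt (f (e, m, (randomWords U (m + e)).length)) := by
    refine Part.dom_iff_mem.1 (Nat.rfindOpt_dom.2 ⟨k, (randomWords U (m + e)).head
      (randomWords_ne_nil U _), ?_⟩)
    simp [f, hk, List.head?_eq_some_head (randomWords_ne_nil U _)]
  have hKx := he m _ x hlt hx
  obtain ⟨k', hk'⟩ := Nat.rfindOpt_spec hx
  simp only [f] at hk'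
  split_ifs at hk' with hle
  · rw [← (randomWords_sublist_unproduced hc _ k').eq_of_length_le hle] at hk'
    obtain ⟨hl, hr⟩ := mem_randomWords.1 (List.mem_of_mem_head? hk')
    rw [← hl] at hKx
    exact absurd hr (not_le.2 hKx)
  · simp at hk'

/-! ### Hitting sets -/

/-- Sets of density at least `1 / (D + 1)` can be hit by few points, chosen greedily: by double
counting, some point lies in at least a fraction `1 / (D + 1)` of the sets that are not yet hit. -/
theorem exists_hitting_list {ι X : Type*} [DecidableEq X] (univ : Finset X) (S : ι → Finset X)
    (D : ℕ) (hne : univ.Nonempty) (k : ℕ) (F : Finset ι)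
    (hF : ∀ i ∈ F, S i ⊆ univ ∧ univ.card ≤ (D + 1) * (S i).card)
    (hk : F.card * D ^ k < (D + 1) ^ k) :
    ∃ B : List X, B.length ≤ k ∧ ∀ i ∈ F, ∃ x ∈ B, x ∈ S i := by
  induction k generalizing F with
  | zero =>
    have : F = ∅ := by simpa using hk
    exact ⟨[], le_rfl, by simp [this]⟩
  | succ k ih =>
    obtain ⟨x, -, hx⟩ : ∃ x ∈ univ, F.card ≤ (D + 1) * (F.filter (x ∈ S ·)).card := by
      refine Finset.exists_le_of_sum_le hne ?_
      have hswap : ∑ x ∈ univ, (F.filter (x ∈ S ·)).card = ∑ i ∈ F, (S i).card := by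
        refine (Finset.sum_card_bipartiteAbove_eq_sum_card_bipartiteBelow (s := univ) (t := F)
          fun x i => x ∈ S i).trans ?_
        refine Finset.sum_congr rfl fun i hi => congrArg _ ?_
        ext x
        simpa using fun h => (hF i hi).1 h
      rw [← Finset.mul_sum, hswap, Finset.mul_sum, Finset.sum_const, smul_eq_mul, mul_comm,
        ← smul_eq_mul, ← Finset.sum_const]
      exact Finset.sum_le_sum fun i hi => (hF i hi).2
    have hsplit := Finset.card_filter_add_card_filter_not (s := F) (x ∈ S ·)
    obtain ⟨B, hB, hit⟩ := ih (F.filter (x ∉ S ·)) (fun i hi => hF i (Finset.mem_filter.1 hi).1) (by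
      have h1 : (F.filter (x ∉ S ·)).card * (D + 1) ≤ F.card * D := by nlinarith
      refine lt_of_mul_lt_mul_right ?_ (Nat.zero_le (D + 1))
      calc (F.filter (x ∉ S ·)).card * D ^ k * (D + 1)
          = (F.filter (x ∉ S ·)).card * (D + 1) * D ^ k := by ring
        _ ≤ F.card * D * D ^ k := by gcongr
        _ = F.card * D ^ (k + 1) := by ring
        _ < (D + 1) ^ k * (D + 1) := by rwa [← pow_succ])
    refine ⟨x :: B, by simpa using hB, fun i hi => ?_⟩
    by_cases h : x ∈ S i
    · exact ⟨x, by simp, h⟩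
    · obtain ⟨y, hy, hyi⟩ := hit i (Finset.mem_filter.2 ⟨hi, h⟩)
      exact ⟨y, by simp [hy], hyi⟩

theorem two_mul_pow_le (D : ℕ) : 2 * D ^ (D + 1) ≤ (D + 1) ^ (D + 1) := by
  have h (n : ℕ) : D ^ (n + 1) + (n + 1) * D ^ n ≤ (D + 1) ^ (n + 1) := by
    induction n with
    | zero => simp
    | succ n ih =>
      calc D ^ (n + 2) + (n + 1 + 1) * D ^ (n + 1)
          ≤ (D ^ (n + 1) + (n + 1) * D ^ n) * (D + 1) := by ring_nf; nlinarith [Nat.zero_le (D ^ n)]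
        _ ≤ (D + 1) ^ (n + 1) * (D + 1) := by gcongr
        _ = _ := by ring
  calc 2 * D ^ (D + 1) = D ^ (D + 1) + D * D ^ D := by ring
    _ ≤ D ^ (D + 1) + (D + 1) * D ^ D := by gcongr; omega
    _ ≤ _ := h D

/-- For fewer than `2 ^ 2 ^ j` sets of density at least `1 / (D + 1) = 2 ^ (-e)`, the hypothesis of
`exists_hitting_list` holds with `2 ^ (e + j)` points. -/
theorem mul_pow_lt_pow_of_lt {N D e j : ℕ} (hD : D + 1 = 2 ^ e) (hN : N < 2 ^ 2 ^ j) :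
    N * D ^ 2 ^ (e + j) < (D + 1) ^ 2 ^ (e + j) := by
  rcases Nat.eq_zero_or_pos D with rfl | h0
  · simp
  · have hpow : (2 : ℕ) ^ (e + j) = (D + 1) * 2 ^ j := by rw [pow_add, hD]
    rw [hpow]
    calc N * D ^ ((D + 1) * 2 ^ j) < 2 ^ 2 ^ j * D ^ ((D + 1) * 2 ^ j) := by gcongr
      _ = (2 * D ^ (D + 1)) ^ 2 ^ j := by rw [mul_pow, pow_mul]
      _ ≤ ((D + 1) ^ (D + 1)) ^ 2 ^ j := Nat.pow_le_pow_left (two_mul_pow_le D) _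
      _ = _ := by rw [pow_mul]

/-- A bound on the number of pairs of a code of index below `n` and an advice string of length at
most `2 ^ r`. -/
theorem mul_length_shortWords_lt {n r : ℕ} (h : n ≤ 2 * r) :
    n * (shortWords (2 ^ r + 1)).length < 2 ^ 2 ^ (r + 2) := by
  have h1 : r + 1 ≤ 2 ^ r := Nat.lt_two_pow_self
  have h2 : 2 ^ r + 1 ≤ 2 ^ 2 ^ r := Nat.lt_two_pow_self
  have h3 : n < 2 * 2 ^ 2 ^ r := by omega
  calc n * (shortWords (2 ^ r + 1)).length ≤ n * 2 ^ (2 ^ r + 1) := by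
        gcongr
        exact (length_shortWords_lt _).le
    _ < 2 * 2 ^ 2 ^ r * 2 ^ (2 ^ r + 1) := by gcongr
    _ = 2 ^ (2 ^ r + 2 ^ r + 2) := by ring
    _ ≤ 2 ^ 2 ^ (r + 2) := by
        refine Nat.pow_le_pow_right two_pos ?_
        have : 2 ^ (r + 2) = 4 * 2 ^ r := by ring
        have := Nat.one_le_two_pow (n := r)
        omega

/-! ### Compressing a hitting set for all candidate deciders -/

open Nat.Partrec (Code)
open Encodable

/-- The strings `x` of length `n` for which the code `c` outputs `1` on `(x, y, T)` within `k`
steps. -/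
def accepted (k n T : ℕ) (c : Code) (y : List Bool) : List (List Bool) :=
  (words n).filter fun x => Code.evaln k c (encode (x, y, T)) = some 1

theorem primrec_evaln_encode : Primrec fun a : List Bool × ((ℕ × ℕ × ℕ) × Code) × List Bool =>
    Code.evaln a.2.1.1.1 a.2.1.2 (encode (a.1, a.2.2, a.2.1.1.2.2)) := by
  have hs : Primrec fun a : List Bool × ((ℕ × ℕ × ℕ) × Code) × List Bool => a.2.1.1 :=
    Primrec.fst.comp (Primrec.fst.comp Primrec.snd)
  exact Code.primrec_evaln.comp (Primrec.pair (Primrec.pair (Primrec.fst.comp hs)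
    (Primrec.snd.comp (Primrec.fst.comp Primrec.snd))) (Primrec.encode.comp
    (Primrec.fst.pair ((Primrec.snd.comp Primrec.snd).pair
      (Primrec.snd.comp (Primrec.snd.comp hs))))))

theorem primrec_accepted : Primrec fun a : ((ℕ × ℕ × ℕ) × Code) × List Bool =>
    accepted a.1.1.1 a.1.1.2.1 a.1.1.2.2 a.1.2 a.2 := by
  have h : PrimrecRel fun (x : List Bool) (a : ((ℕ × ℕ × ℕ) × Code) × List Bool) =>
      Code.evaln a.1.1.1 a.1.2 (encode (x, a.2, a.1.1.2.2)) = some 1 :=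
    Primrec.eq.comp primrec_evaln_encode (Primrec.const (some 1))
  exact h.listFilter.comp (primrec_words.comp (Primrec.fst.comp (Primrec.snd.comp
    (Primrec.fst.comp Primrec.fst)))) Primrec.id

/-- The list `B` deals with the code `c` and the advice `y`: if `c` is free of unbounded search,
then `k` steps suffice for all strings of length `n`, and `B` contains an accepted string unless
fewer than a fraction `1 / E` of the strings is accepted. -/
def Handles (E k n T : ℕ) (B : List (List Bool)) (c : Code) (y : List Bool) : Prop :=
  c.rfindFree = true → (∀ x ∈ words n, (Code.evaln k c (encode (x, y, T))).isSome = true) ∧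
    (2 ^ n ≤ E * (accepted k n T c y).length → ∃ x ∈ B, x ∈ accepted k n T c y)

theorem primrecPred_handles (E : ℕ) : PrimrecPred
    fun a : (((ℕ × ℕ × ℕ) × List (List Bool)) × Code) × List Bool =>
      Handles E a.1.1.1.1 a.1.1.1.2.1 a.1.1.1.2.2 a.1.1.2 a.1.2 a.2 := by
  have hs : Primrec fun a : (((ℕ × ℕ × ℕ) × List (List Bool)) × Code) × List Bool => a.1.1.1 :=
    Primrec.fst.comp (Primrec.fst.comp Primrec.fst)
  have hB : Primrec fun a : (((ℕ × ℕ × ℕ) × List (List Bool)) × Code) × List Bool => a.1.1.2 :=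
    Primrec.snd.comp (Primrec.fst.comp Primrec.fst)
  have hc : Primrec fun a : (((ℕ × ℕ × ℕ) × List (List Bool)) × Code) × List Bool => a.1.2 :=
    Primrec.snd.comp Primrec.fst
  have hn : Primrec fun a : (((ℕ × ℕ × ℕ) × List (List Bool)) × Code) × List Bool =>
      a.1.1.1.2.1 := Primrec.fst.comp (Primrec.snd.comp hs)
  have hacc := primrec_accepted.comp ((hs.pair hc).pair Primrec.snd)
  have h1 : PrimrecPred fun a : (((ℕ × ℕ × ℕ) × List (List Bool)) × Code) × List Bool =>
      a.1.2.rfindFree = true :=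
    Primrec.eq.comp (Code.primrec_rfindFree.comp hc) (Primrec.const true)
  have h2 : PrimrecRel fun (x : List Bool) (a : ((ℕ × ℕ × ℕ) × Code) × List Bool) =>
      (Code.evaln a.1.1.1 a.1.2 (encode (x, a.2, a.1.1.2.2))).isSome = true :=
    Primrec.eq.comp (Primrec.option_isSome.comp primrec_evaln_encode) (Primrec.const true)
  have h3 := h2.forall_mem_list.comp (primrec_words.comp hn) ((hs.pair hc).pair Primrec.snd)
  have h4 := Primrec.nat_le.comp ((Primrec₂.unpaired'.1 Nat.Primrec.pow).comp
    (Primrec.const 2) hn) (Primrec.nat_mul.comp (Primrec.const E) (Primrec.list_length.comp hacc))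
  have h5 : PrimrecRel fun x (l : List (List Bool)) => ∃ y ∈ l, y = x :=
    (Primrec.eq (α := List Bool)).exists_mem_list.comp Primrec.snd Primrec.fst
  have h6 := h5.exists_mem_list.comp hB hacc
  refine (h1.not.or (h3.and (h4.not.or h6))).of_eq fun a => ?_
  simp only [Handles, imp_iff_not_or, exists_eq_right]

/-- The list `B` has at most `2 ^ m` entries and deals with all codes of index below `n` and all
advice strings of length at most `2 ^ r`. -/
def HandlesAll (E m r k n T : ℕ) (B : List (List Bool)) : Prop :=
  B.length ≤ 2 ^ m ∧ ∀ i ∈ List.range n, ∀ y ∈ shortWords (2 ^ r + 1),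
    Handles E k n T B (Denumerable.ofNat Code i) y

theorem primrecPred_handlesAll (E : ℕ) : PrimrecPred
    fun a : (ℕ × ℕ) × (ℕ × ℕ × ℕ) × List (List Bool) =>
      HandlesAll E a.1.1 a.1.2 a.2.1.1 a.2.1.2.1 a.2.1.2.2 a.2.2 := by
  have hpow : Primrec₂ fun a b : ℕ => a ^ b := Primrec₂.unpaired'.1 Nat.Primrec.pow
  have h1 : PrimrecRel fun (y : List Bool) (b : ((ℕ × ℕ × ℕ) × List (List Bool)) × Code) =>
      Handles E b.1.1.1 b.1.1.2.1 b.1.1.2.2 b.1.2 b.2 y :=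
    (primrecPred_handles E).comp (Primrec.snd.pair Primrec.fst)
  have h2 : PrimrecRel fun (i : ℕ) (a : (ℕ × ℕ) × (ℕ × ℕ × ℕ) × List (List Bool)) =>
      ∀ y ∈ shortWords (2 ^ a.1.2 + 1),
        Handles E a.2.1.1 a.2.1.2.1 a.2.1.2.2 a.2.2 (Denumerable.ofNat Code i) y :=
    h1.forall_mem_list.comp (primrec_shortWords.comp (Primrec.succ.comp (hpow.comp
      (Primrec.const 2) (Primrec.snd.comp (Primrec.fst.comp Primrec.snd)))))
      ((Primrec.snd.comp Primrec.snd).pair ((Primrec.ofNat Code).comp Primrec.fst))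
  exact (Primrec.nat_le.comp (Primrec.list_length.comp (Primrec.snd.comp Primrec.snd))
    (hpow.comp (Primrec.const 2) (Primrec.fst.comp Primrec.fst))).and
    (h2.forall_mem_list.comp (Primrec.list_range.comp (Primrec.fst.comp (Primrec.snd.comp
      (Primrec.fst.comp Primrec.snd)))) Primrec.id)

open Classical in
/-- The first `B` found that deals with everything within some number of steps `k`; the parameters
`m`, `r`, `n` and `T` are given as a function of `a`. -/
noncomputable def searchHandlesAll {α : Type*} (E : ℕ) (s : α → (ℕ × ℕ) × ℕ × ℕ) :
    α →. List (List Bool) := fun a =>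
  Nat.rfindOpt fun j => (decode (α := ℕ × List (List Bool)) j).bind fun b =>
    if HandlesAll E (s a).1.1 (s a).1.2 b.1 (s a).2.1 (s a).2.2 b.2 then some b.2 else none

theorem partrec_searchHandlesAll {α : Type*} [Primcodable α] (E : ℕ)
    {s : α → (ℕ × ℕ) × ℕ × ℕ} (hs : Computable s) : Partrec (searchHandlesAll E s) := by
  classical
  have h1 : Primrec₂ fun (p : (ℕ × ℕ) × ℕ × ℕ) (b : ℕ × List (List Bool)) =>
      if HandlesAll E p.1.1 p.1.2 b.1 p.2.1 p.2.2 b.2 then some b.2 else none :=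
    Primrec.ite ((primrecPred_handlesAll E).comp ((Primrec.fst.comp Primrec.fst).pair
      (((Primrec.fst.comp Primrec.snd).pair (Primrec.snd.comp Primrec.fst)).pair
        (Primrec.snd.comp Primrec.snd))))
      (Primrec.option_some.comp (Primrec.snd.comp Primrec.snd)) (Primrec.const none)
  exact Partrec.rfindOpt (Computable.option_bind (Computable.decode.comp Computable.snd)
    (h1.to_comp.comp (hs.comp (Computable.fst.comp Computable.fst)) Computable.snd))

theorem exists_mem_searchHandlesAll {α : Type*} {E : ℕ} {s : α → (ℕ × ℕ) × ℕ × ℕ} {a : α}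
    {k : ℕ} {B : List (List Bool)}
    (h : HandlesAll E (s a).1.1 (s a).1.2 k (s a).2.1 (s a).2.2 B) :
    ∃ B, B ∈ searchHandlesAll E s a :=
  Part.dom_iff_mem.1 (Nat.rfindOpt_dom.2 ⟨encode (k, B), B, by
    rw [encodek, Option.bind_some, if_pos h]
    exact rfl⟩)

theorem handlesAll_of_mem_search {α : Type*} {E : ℕ} {s : α → (ℕ × ℕ) × ℕ × ℕ} {a : α}
    {B : List (List Bool)} (h : B ∈ searchHandlesAll E s a) :
    ∃ k, HandlesAll E (s a).1.1 (s a).1.2 k (s a).2.1 (s a).2.2 B := by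
  obtain ⟨j, hj⟩ := Nat.rfindOpt_spec h
  obtain ⟨⟨k, B'⟩, -, hkB⟩ := Option.bind_eq_some_iff.1 hj
  split_ifs at hkB with hPB
  obtain rfl : B' = B := Option.some.inj hkB
  exact ⟨k, hPB⟩

/-- The greedy hitting list deals with all codes and advice strings, as soon as `k` exceeds the
finitely many running times involved. -/
theorem exists_handlesAll {e m r n : ℕ} (T : ℕ) (hm : m = e + (r + 2)) (hn : n ≤ 2 * r) :
    ∃ k B, HandlesAll (2 ^ e) m r k n T B := by
  have hfin : ∀ᶠ k in atTop, ∀ a ∈ Finset.range n ×ˢ (shortWords (2 ^ r + 1)).toFinset ×ˢ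
      (words n).toFinset, (Denumerable.ofNat Code a.1).rfindFree = true →
      (Code.evaln k (Denumerable.ofNat Code a.1) (encode (a.2.2, a.2.1, T))).isSome = true := by
    refine (eventually_all_finset _).2 fun a _ => ?_
    by_cases hc : (Denumerable.ofNat Code a.1).rfindFree = true
    · obtain ⟨b, hb⟩ := Part.dom_iff_mem.1
        (Code.eval_dom_of_rfindFree hc (encode (a.2.2, a.2.1, T)))
      obtain ⟨k₀, hk₀⟩ := Code.evaln_complete.1 hb
      filter_upwards [eventually_ge_atTop k₀] with k hk _
      exact Option.isSome_iff_exists.2 ⟨b, Code.evaln_mono hk hk₀⟩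
    · exact Eventually.of_forall fun _ h => absurd h hc
  obtain ⟨k, hk⟩ := hfin.exists
  obtain ⟨D, hD⟩ : ∃ D, D + 1 = 2 ^ e :=
    ⟨2 ^ e - 1, Nat.sub_add_cancel Nat.one_le_two_pow⟩
  let S (a : ℕ × List Bool) : Finset (List Bool) :=
    (accepted k n T (Denumerable.ofNat Code a.1) a.2).toFinset
  have hS (a : ℕ × List Bool) :
      (S a).card = (accepted k n T (Denumerable.ofNat Code a.1) a.2).length :=
    List.toFinset_card_of_nodup ((nodup_words n).filter _)
  have hcard : (words n).toFinset.card = 2 ^ n := by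
    rw [List.toFinset_card_of_nodup (nodup_words n), length_words]
  let F := (Finset.range n ×ˢ (shortWords (2 ^ r + 1)).toFinset).filter
    fun a => 2 ^ n ≤ 2 ^ e * (S a).card
  have hFc : F.card < 2 ^ 2 ^ (r + 2) := by
    refine ((Finset.card_filter_le _ _).trans ?_).trans_lt (mul_length_shortWords_lt hn)
    rw [Finset.card_product, Finset.card_range]
    exact Nat.mul_le_mul_left _ (List.toFinset_card_le _)
  have hF : ∀ a ∈ F, S a ⊆ (words n).toFinset ∧
      (words n).toFinset.card ≤ (D + 1) * (S a).card := fun a ha =>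
    ⟨fun x hx => List.mem_toFinset.2 (List.filter_subset_self _ (List.mem_toFinset.1 hx)), by
      rw [hcard, hD]
      exact (Finset.mem_filter.1 ha).2⟩
  obtain ⟨B, hB, hit⟩ := exists_hitting_list (words n).toFinset S D
    (Finset.card_pos.1 (by rw [hcard]; positivity)) (2 ^ m) F hF
    (hm ▸ mul_pow_lt_pow_of_lt hD hFc)
  refine ⟨k, B, hB, fun i hi y hy hc => ⟨fun x hx => hk (i, y, x) ?_ hc, fun hbig => ?_⟩⟩
  · simp only [Finset.mem_product, List.mem_toFinset, Finset.mem_range]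
    exact ⟨List.mem_range.1 hi, hy, hx⟩
  · have hiy : (i, y) ∈ F := by
      refine Finset.mem_filter.2 ⟨?_, by rwa [hS]⟩
      simp only [Finset.mem_product, List.mem_toFinset, Finset.mem_range]
      exact ⟨List.mem_range.1 hi, hy⟩
    obtain ⟨x, hxB, hx⟩ := hit (i, y) hiy
    exact ⟨x, hxB, List.mem_toFinset.1 hx⟩

theorem exists_rfindFree_code {α : Type*} [Primcodable α] {g : α → Bool} (hg : Primrec g) :
    ∃ c : Code, c.rfindFree = true ∧ ∀ a, c.eval (encode a) = Part.some (encode (g a)) := by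
  -- The natural-number presentation of `g` outputs `encode (some (g a))`, which is one too large.
  obtain ⟨c, hc, he⟩ := Code.exists_rfindFree (Nat.Primrec.pred.comp hg)
  exact ⟨c, hc, fun a => by simp [he]⟩

/-- If `B` deals with a code and an advice string that decide a language on the length `n`, and the
language contains enough strings of that length, then one of them is in `B`. -/
theorem Handles.exists_mem {E k n T : ℕ} {B : List (List Bool)} {c : Code} {y : List Bool}
    {g : List Bool × List Bool × ℕ → Bool} (h : Handles E k n T B c y)
    (hc : c.rfindFree = true) (hg : ∀ a, c.eval (encode a) = Part.some (encode (g a)))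
    {l : List (List Bool)} (hl : l.Nodup) (hlg : ∀ x ∈ l, x.length = n ∧ g (x, y, T) = true)
    (hbig : 2 ^ n ≤ E * l.length) : ∃ x ∈ B, x.length = n ∧ g (x, y, T) = true := by
  obtain ⟨hk, hit⟩ := h hc
  have hmem (x : List Bool) : x ∈ accepted k n T c y ↔ x.length = n ∧ g (x, y, T) = true := by
    rw [accepted, List.mem_filter, decide_eq_true_iff, mem_words]
    refine and_congr_right fun hx => ?_
    obtain ⟨b, hb⟩ := Option.isSome_iff_exists.1 (hk x (mem_words.2 hx))
    have hb' := Code.evaln_sound (Option.mem_def.2 hb)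
    rw [hg, Part.mem_some_iff] at hb'
    rw [hb, hb']
    cases g (x, y, T) <;> simp
  obtain ⟨x, hx, hxa⟩ := hit (hbig.trans (Nat.mul_le_mul_left _
    (hl.subperm fun x hx => (hmem x).2 (hlg x hx)).length_le))
  exact ⟨x, hx, (hmem x).1 hxa⟩

theorem theorem1 (U : List Bool →. List Bool) (hU : IsUniversalMachine U)
    (t : ℕ → ℕ) (ht : Computable t) :
    ∃ d : ℕ, randomStrings U ∉
      InfinitelyOften (DTIMEAdvice t (fun n => (2 : ℝ) ^ ((n : ℤ) - (d : ℤ)))) := by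
  obtain ⟨e₀, he₀⟩ := hU.exists_two_pow_le_length_randomWords
  -- For the overhead `e` and `m = e₀ + (r + 2)`, the list has at most `2 ^ m` entries and deals
  -- with the length `n = m + e` and advice of length at most `2 ^ r`, where `r = n - (e + e₀ + 2)`.
  let H := searchHandlesAll (2 ^ e₀)
    (fun s : ℕ × ℕ => ((s.2, s.2 - (e₀ + 2)), s.2 + s.1, t (s.2 + s.1)))
  have hn : Computable fun s : ℕ × ℕ => s.2 + s.1 :=
    Primrec.to_comp (Primrec.nat_add.comp Primrec.snd Primrec.fst)
  have hH : Partrec H := partrec_searchHandlesAll _ ((Computable.snd.pair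
    (Primrec.to_comp (Primrec.nat_sub.comp Primrec.snd (Primrec.const _)))).pair
      (hn.pair (ht.comp hn)))
  let W : ℕ × ℕ × ℕ →. List Bool := fun s =>
    (H (s.1, s.2.1)).bind fun B => (B[s.2.2]? : Option (List Bool))
  have hW : Partrec W := by
    refine Partrec.bind (hH.comp
      (Computable.fst.pair (Computable.fst.comp Computable.snd))) ?_
    exact Computable.ofOption (Computable.list_getElem?.comp Computable.snd
      (Computable.snd.comp (Computable.snd.comp Computable.fst)))
  obtain ⟨e, he⟩ := hU.exists_kolmogorov_lt hW
  -- Both `e₀` and `e` come from machines built from `U` and `t` alone: `d` depends on no decider.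
  refine ⟨e + e₀ + 2, ?_⟩
  rintro ⟨L, ⟨α, hα, hL⟩, hio⟩
  obtain ⟨g, hg, hgL⟩ := exists_primrec_decider hL
  obtain ⟨c, hc, hcg⟩ := exists_rfindFree_code hg
  -- The length must be beyond the index of the decider, for that code to be among the candidates,
  -- and at least `2 * d`, for `exists_handlesAll` to apply.
  obtain ⟨n, hn, hRL⟩ := frequently_atTop.1 hio (max (encode c + 1) (2 * (e + e₀ + 2)))
  obtain ⟨r, hr⟩ : ∃ r, n = r + (e + e₀ + 2) := Nat.exists_eq_add_of_le' (by omega)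
  obtain ⟨m, hm⟩ : ∃ m, m = e₀ + (r + 2) := ⟨_, rfl⟩
  have hnm : m + e = n := by omega
  have hrm : m - (e₀ + 2) = r := by omega
  obtain ⟨B, hB⟩ : ∃ B, B ∈ H (e, m) := by
    obtain ⟨k, B, hkB⟩ := exists_handlesAll (e := e₀) (r := r) (n := n) (t n) hm (by omega)
    refine exists_mem_searchHandlesAll (k := k) (B := B) ?_
    simpa only [hnm, hrm] using hkB
  obtain ⟨k, hPB⟩ := handlesAll_of_mem_search hB
  simp only [hnm, hrm] at hPB
  have hαn : α n ∈ shortWords (2 ^ r + 1) := by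
    rw [mem_shortWords, Nat.lt_succ_iff]
    have h := hα n
    have hexp : (n : ℤ) - ((e + e₀ + 2 : ℕ) : ℤ) = (r : ℤ) := by omega
    simp only [hexp, zpow_natCast] at h
    exact_mod_cast h
  have hhandle := hPB.2 (encode c) (List.mem_range.2 (by omega)) (α n) hαn
  rw [Denumerable.ofNat_encode] at hhandle
  obtain ⟨x, hxB, hxn, hgx⟩ := hhandle.exists_mem hc hcg ((nodup_words n).filter _)
    (l := randomWords U n) (fun x hx => by
      obtain ⟨hxn, hxR⟩ := mem_randomWords.1 hx
      have := (hgL x).1 ((hRL x hxn).1 hxR)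
      rw [hxn] at this
      exact ⟨hxn, this⟩) (by
      have h := he₀ (r + 2 + e)
      rw [show r + 2 + e + e₀ = n by omega] at h
      calc 2 ^ n = 2 ^ e₀ * 2 ^ (r + 2 + e) := by rw [← pow_add]; congr 1; omega
        _ ≤ _ := Nat.mul_le_mul_left _ h)
  have hxR : x ∈ randomStrings U := by
    refine (hRL x hxn).2 ((hgL x).2 ?_)
    rwa [hxn]
  obtain ⟨v, hv, rfl⟩ := List.mem_iff_getElem.1 hxB
  have hlt := he m v B[v] (hv.trans_le hPB.1) (Part.mem_bind_iff.2 ⟨B, hB, by simp [hv]⟩)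
  rw [hnm, ← hxn] at hlt
  exact not_le.2 hlt hxR
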